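/- Let $K\subset\mathbb R^2$ be any compact set and let $u\in C_c^2(\mathbb R^2;\mathbb R^2)$ be a vector field with $\operatorname{div}u=0$ in $\mathbb R^2$. Suppose that $u=0$ and $\nabla u=0$ at every point of $K$. Then there exists a sequence $(u_k)_{k}\subset C_c^\infty(\mathbb R^2;\mathbb R^2)$ with $\operatorname{div}u_k=0$ in $\mathbb R^2$ and $\operatorname{supp}u_k\subset\mathbb R^2\setminus K$ for every $k$, such that $u_k\to u$ in $C^1(\mathbb R^2;\mathbb R^2)$; that is, $\sup_{\mathbb R^2}|u_k-u|+\sup_{\mathbb R^2}|\nabla u_k-\nabla u|\to 0$ as $k\to\infty$. -/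

import Mathlib

open scoped ContDiff Topology

/-- The Euclidean plane. -/
abbrev Plane : Type := EuclideanSpace ℝ (Fin 2)

/-- The divergence `∂₁ u₁ + ∂₂ u₂` of a (differentiable) planar vector field. -/
noncomputable def planeDiv (u : Plane → Plane) (x : Plane) : ℝ :=
  ∑ i : Fin 2, (fderiv ℝ u x (EuclideanSpace.single i 1)) i

/-- Convergence in `C¹(ℝ²; ℝ²)`: the fields and their first derivatives converge uniformly
on the whole plane. -/
def TendstoC1 (v : ℕ → Plane → Plane) (u : Plane → Plane) : Prop :=
  TendstoUniformly v u Filter.atTop ∧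
    TendstoUniformly (fun k x => fderiv ℝ (v k) x) (fun x => fderiv ℝ u x) Filter.atTop

/-! ### Mollification with scale-invariant derivative bounds. -/

section
open MeasureTheory Metric Set Filter
open scoped Convolution

/-! Write `u` as the rotated gradient of a stream function `ψ`. Since `u` and its derivative vanish
on `K`, `ψ` differs from `ψ p` by `O(dist ^ 3)` at each `p ∈ K`
(`exists_stream_function_of_vanishing`). As in Sard's theorem, `ψ '' K` is then null, so a
1-Lipschitz `g` uniformly close to the identity is locally constant near it. The function `H = g ∘
ψ` is locally constant near `K` and keeps the cubic bound, but is only Lipschitz where `ψ` varies.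

The main step, `exists_multiscale_approx`, passes from `ψ` to `H` near `K` without losing second
derivatives. It adds cut-off differences of mollifications of `H` at dyadic scales `t`. At distance
`O(t)` from `K` the cubic bound makes each difference `O(t ^ 3)`, so two derivatives still leave
`O(t)`, and the scales sum geometrically. Finitely many scales reach the neighbourhood where `H` is
locally constant. The rotated gradient of the result is divergence-free, `C¹`-close to `u` and zero
near `K`; an ordinary mollification makes it smooth. -/

theorem hasFDerivAt_convolution_lsmul {F : Type*} [NormedAddCommGroup F] [NormedSpace ℝ F]
    {f : Plane → ℝ} {g : Plane → F} (hf : LocallyIntegrable f)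
    (hgc : HasCompactSupport g) (hg : ContDiff ℝ 1 g) (x : Plane) :
    HasFDerivAt (f ⋆[ContinuousLinearMap.lsmul ℝ ℝ, volume] g)
      ((f ⋆[ContinuousLinearMap.lsmul ℝ ℝ, volume] fderiv ℝ g) x) x := by
  have := hgc.hasFDerivAt_convolution_right (ContinuousLinearMap.lsmul ℝ ℝ : ℝ →L[ℝ] F →L[ℝ] F)
    hf hg x
  exact this

/-- All derivatives fall on `g`, so `f` may be rough. The induction replaces `g` by `fderiv ℝ g`,
hence the varying codomain. -/
theorem norm_iteratedFDeriv_convolution_lsmul_le (n : ℕ) {F : Type} [NormedAddCommGroup F]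
    [NormedSpace ℝ F] {f : Plane → ℝ} {g : Plane → F} (hf : LocallyIntegrable f)
    (hgc : HasCompactSupport g) (hg : ContDiff ℝ ∞ g) (x : Plane) :
    ‖iteratedFDeriv ℝ n (f ⋆[ContinuousLinearMap.lsmul ℝ ℝ, volume] g) x‖ ≤
      ∫ y, |f y| * ‖iteratedFDeriv ℝ n g (x - y)‖ := by
  induction n generalizing F g with
  | zero =>
    simp only [norm_iteratedFDeriv_zero]
    refine (norm_integral_le_integral_norm _).trans_eq ?_
    simp [norm_smul]
  | succ n ih =>
    have h : fderiv ℝ (f ⋆[ContinuousLinearMap.lsmul ℝ ℝ, volume] g) =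
        f ⋆[ContinuousLinearMap.lsmul ℝ ℝ, volume] fderiv ℝ g := by
      ext1 y
      exact (hasFDerivAt_convolution_lsmul hf hgc (hg.of_le (by simp)) y).fderiv
    rw [← norm_iteratedFDeriv_fderiv, h]
    simp only [← norm_iteratedFDeriv_fderiv (n := n) (f := g)]
    exact ih (hgc.fderiv ℝ) (hg.fderiv_right (by simp))

/-- A fixed smooth bump function supported in the unit ball of the plane. -/
noncomputable def unitBump : ContDiffBump (0 : Plane) := ⟨1 / 2, 1, by norm_num, by norm_num⟩

/-- The mollification kernel of mass one at scale `t`. -/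
noncomputable def mollKernel (t : ℝ) (x : Plane) : ℝ :=
  (t ^ 2)⁻¹ * unitBump.normed volume (t⁻¹ • x)

/-- Mollification at scale `t`. -/
noncomputable def mollify (t : ℝ) (f : Plane → ℝ) : Plane → ℝ :=
  f ⋆[ContinuousLinearMap.lsmul ℝ ℝ, volume] mollKernel t

theorem contDiff_mollKernel (t : ℝ) : ContDiff ℝ ∞ (mollKernel t) :=
  contDiff_const.mul (unitBump.contDiff_normed.comp (contDiff_const_smul _))

theorem mollKernel_eq_zero {t : ℝ} (ht : 0 < t) {x : Plane} (hx : x ∉ ball 0 t) :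
    mollKernel t x = 0 := by
  have : t⁻¹ • x ∉ Function.support (unitBump.normed volume) := by
    rw [unitBump.support_normed_eq]
    simp only [unitBump, mem_ball_zero_iff, not_lt, norm_smul, norm_inv, Real.norm_eq_abs,
      abs_of_pos ht] at hx ⊢
    rwa [inv_mul_eq_div, one_le_div ht]
  simp [mollKernel, Function.notMem_support.1 this]

theorem tsupport_mollKernel_subset {t : ℝ} (ht : 0 < t) :
    tsupport (mollKernel t) ⊆ closedBall 0 t :=
  closure_minimal (fun x hx => by
    by_contra h
    exact hx (mollKernel_eq_zero ht fun h' => h (ball_subset_closedBall h'))) isClosed_closedBall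

theorem hasCompactSupport_mollKernel {t : ℝ} (ht : 0 < t) : HasCompactSupport (mollKernel t) :=
  (isCompact_closedBall 0 t).of_isClosed_subset (isClosed_tsupport _)
    (tsupport_mollKernel_subset ht)

theorem integral_norm_iteratedFDeriv_mollKernel {t : ℝ} (ht : 0 < t) (n : ℕ) :
    ∫ y, ‖iteratedFDeriv ℝ n (mollKernel t) y‖ =
      (∫ y, ‖iteratedFDeriv ℝ n (unitBump.normed volume) y‖) * t⁻¹ ^ n := by
  have h (y : Plane) : ‖iteratedFDeriv ℝ n (mollKernel t) y‖ =
      (t ^ 2)⁻¹ * t⁻¹ ^ n * ‖iteratedFDeriv ℝ n (unitBump.normed volume) (t⁻¹ • y)‖ := by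
    have h1 : mollKernel t =
        (t ^ 2)⁻¹ • fun x => unitBump.normed volume (t⁻¹ • x) := rfl
    have hc : ContDiff ℝ n (unitBump.normed (volume : Measure Plane)) := unitBump.contDiff_normed
    have hc' : ContDiff ℝ n fun x : Plane => unitBump.normed (volume : Measure Plane) (t⁻¹ • x) :=
      hc.comp (contDiff_const_smul _)
    rw [h1, iteratedFDeriv_const_smul_apply hc'.contDiffAt,
      iteratedFDeriv_comp_const_smul _ hc, norm_smul, norm_smul, norm_pow, norm_inv, norm_inv,
      norm_pow, Real.norm_of_nonneg ht.le, mul_assoc]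
  simp only [h]
  rw [integral_const_mul, Measure.integral_comp_inv_smul volume
    (fun y => ‖iteratedFDeriv ℝ n (unitBump.normed (volume : Measure Plane)) y‖)]
  simp only [finrank_euclideanSpace, Fintype.card_fin, smul_eq_mul, abs_of_pos (pow_pos ht 2)]
  field_simp

theorem integral_mollKernel {t : ℝ} (ht : 0 < t) : ∫ y, mollKernel t y = 1 := by
  simp only [mollKernel]
  rw [integral_const_mul, Measure.integral_comp_inv_smul volume
    (fun y => unitBump.normed (volume : Measure Plane) y), unitBump.integral_normed]
  simp only [finrank_euclideanSpace, Fintype.card_fin, smul_eq_mul, abs_of_pos (pow_pos ht 2)]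
  field_simp

theorem contDiff_mollify {t : ℝ} (ht : 0 < t) {f : Plane → ℝ} (hf : LocallyIntegrable f) :
    ContDiff ℝ ∞ (mollify t f) :=
  (hasCompactSupport_mollKernel ht).contDiff_convolution_right _ hf (contDiff_mollKernel t)

theorem mollify_sub_const {t : ℝ} (ht : 0 < t) {f : Plane → ℝ} (hf : LocallyIntegrable f)
    (c : ℝ) (x : Plane) : mollify t f x - c = mollify t (fun y => f y - c) x := by
  have h1 : ConvolutionExistsAt f (mollKernel t) x (ContinuousLinearMap.lsmul ℝ ℝ) volume :=
    (hasCompactSupport_mollKernel ht).convolutionExists_right _ hf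
      (contDiff_mollKernel t).continuous x
  have h2 : ConvolutionExistsAt (fun _ => c) (mollKernel t) x
      (ContinuousLinearMap.lsmul ℝ ℝ) volume :=
    (hasCompactSupport_mollKernel ht).convolutionExists_right _ (locallyIntegrable_const c)
      (contDiff_mollKernel t).continuous x
  have h3 : ∫ y, c * mollKernel t (x - y) = c := by
    rw [integral_const_mul, integral_sub_left_eq_self (mollKernel t) volume x,
      integral_mollKernel ht, mul_one]
  conv_lhs => rw [← h3]
  simp only [mollify, convolution, ContinuousLinearMap.lsmul_apply, smul_eq_mul, sub_mul]
  exact (integral_sub h1 h2).symm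

/-- Scale-invariant derivative bounds for mollification, in terms of the local oscillation. -/
theorem exists_norm_iteratedFDeriv_mollify_le : ∃ A : ℝ, 1 ≤ A ∧ ∀ n ≤ 2, ∀ t : ℝ, 0 < t →
    ∀ f : Plane → ℝ, LocallyIntegrable f → ∀ (c M : ℝ) (x : Plane),
    (∀ y ∈ closedBall x t, |f y - c| ≤ M) →
      ‖iteratedFDeriv ℝ n (fun z => mollify t f z - c) x‖ ≤ A * M * t⁻¹ ^ n := by
  set I : ℕ → ℝ := fun n => ∫ y, ‖iteratedFDeriv ℝ n (unitBump.normed (volume : Measure Plane)) y‖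
    with hI
  have hI0 (n : ℕ) : 0 ≤ I n := integral_nonneg fun _ => norm_nonneg _
  refine ⟨1 + ∑ n ∈ Finset.range 3, I n, by simpa using Finset.sum_nonneg fun n _ => hI0 n, ?_⟩
  intro n hn t ht f hf c M x hM
  have hM0 : 0 ≤ M := (abs_nonneg _).trans (hM x (mem_closedBall_self ht.le))
  have hA : I n ≤ 1 + ∑ n ∈ Finset.range 3, I n :=
    (Finset.single_le_sum (fun i _ => hI0 i) (Finset.mem_range.2 (show n < 3 by omega))).trans (by simp)
  have hfc : LocallyIntegrable (fun y => f y - c) := hf.sub (locallyIntegrable_const c)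
  -- The kernel has mass one, so the constant can be moved inside and only the oscillation of `f`
  -- matters.
  simp only [mollify_sub_const ht hf]
  have hcont : Continuous fun y => ‖iteratedFDeriv ℝ n (mollKernel t) y‖ :=
    ((contDiff_mollKernel t).continuous_iteratedFDeriv (by exact_mod_cast le_top)).norm
  have hcs : HasCompactSupport fun y => ‖iteratedFDeriv ℝ n (mollKernel t) y‖ :=
    ((hasCompactSupport_mollKernel ht).iteratedFDeriv n).norm
  calc _ ≤ ∫ y, |f y - c| * ‖iteratedFDeriv ℝ n (mollKernel t) (x - y)‖ :=
        norm_iteratedFDeriv_convolution_lsmul_le n hfc (hasCompactSupport_mollKernel ht)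
          (contDiff_mollKernel t) x
    _ ≤ ∫ y, M * ‖iteratedFDeriv ℝ n (mollKernel t) (x - y)‖ := by
        refine integral_mono_of_nonneg (ae_of_all _ fun y => by positivity) ?_
          (ae_of_all _ fun y => ?_)
        · exact ((hcont.integrable_of_hasCompactSupport hcs).comp_sub_left x).const_mul M
        · by_cases hy : y ∈ closedBall x t
          · exact mul_le_mul_of_nonneg_right (hM y hy) (norm_nonneg _)
          · have : iteratedFDeriv ℝ n (mollKernel t) (x - y) = 0 := by
              by_contra h
              have := tsupport_mollKernel_subset ht (support_iteratedFDeriv_subset n h)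
              rw [mem_closedBall_zero_iff, ← dist_eq_norm] at this
              exact hy (by rwa [mem_closedBall'])
            simp [this]
    _ = I n * M * t⁻¹ ^ n := by
        rw [integral_const_mul, integral_sub_left_eq_self
          (fun y => ‖iteratedFDeriv ℝ n (mollKernel t) y‖) volume x,
          integral_norm_iteratedFDeriv_mollKernel ht]
        ring
    _ ≤ _ := by gcongr

end

/-! ### Null images, flattening functions and a scaled Leibniz rule. -/

section
open MeasureTheory Metric Set Filter
open scoped Convolution ENNReal NNReal

/-- A Hölder map of exponent 3 divides Hausdorff dimension by 3, and `2 / 3 < 1`. -/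
theorem volume_image_eq_zero_of_cubic {K : Set Plane} {ψ : Plane → ℝ} {C : ℝ}
    (h : ∀ x ∈ K, ∀ y ∈ K, |ψ x - ψ y| ≤ C * dist x y ^ 3) : volume (ψ '' K) = 0 := by
  have hH : HolderOnWith C.toNNReal 3 ψ K := by
    intro x hx y hy
    rw [edist_dist, edist_dist, Real.dist_eq]
    have h3 : (ENNReal.ofReal (dist x y)) ^ ((3 : ℝ≥0) : ℝ) = ENNReal.ofReal (dist x y ^ 3) := by
      rw [ENNReal.ofReal_pow dist_nonneg, ← ENNReal.rpow_natCast]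
      norm_num
    rw [h3, ← ENNReal.ofReal.eq_1, ← ENNReal.ofReal_mul' (by positivity)]
    exact ENNReal.ofReal_le_ofReal (h x hx y hy)
  have h1 : dimH (ψ '' K) < ((1 : ℝ≥0) : ℝ≥0∞) := by
    refine (hH.dimH_image_le (by norm_num)).trans_lt ?_
    have h2 : dimH K ≤ 2 := by
      refine (dimH_mono (subset_univ K)).trans_eq ?_
      rw [Real.dimH_univ_eq_finrank]
      simp
    calc dimH K / ((3 : ℝ≥0) : ℝ≥0∞) ≤ 2 / 3 := by
          have : ((3 : ℝ≥0) : ℝ≥0∞) = 3 := by norm_num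
          rw [this]; gcongr
      _ < 1 := by
          rw [ENNReal.div_lt_iff (by norm_num) (by norm_num)]; norm_num
      _ = _ := by simp
  have := hausdorffMeasure_of_dimH_lt h1
  simpa [hausdorffMeasure_real] using this

/-- A one-Lipschitz function, close to the identity, which is locally constant near a given
null set. -/
theorem exists_lipschitz_locallyConstant_near_null {Z : Set ℝ} (hZ : volume Z = 0) {η : ℝ}
    (hη : 0 < η) : ∃ h : ℝ → ℝ, LipschitzWith 1 h ∧ (∀ s, |h s - s| ≤ η) ∧
      ∀ z ∈ Z, ∀ᶠ s in 𝓝 z, h s = h z := by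
  obtain ⟨U, hZU, hUo, hU⟩ := Z.exists_isOpen_lt_of_lt (ENNReal.ofReal η)
    (by rw [hZ]; exact ENNReal.ofReal_pos.2 hη)
  have hUt : volume U ≠ ⊤ := hU.ne_top
  have hfin (S : Set ℝ) : volume (U ∩ S) ≠ ⊤ := measure_ne_top_of_subset inter_subset_left hUt
  have hadd {s t : ℝ} (hst : s ≤ t) :
      volume.real (U ∩ Iic t) = volume.real (U ∩ Iic s) + volume.real (U ∩ Ioc s t) := by
    rw [← measureReal_union _ (hUo.measurableSet.inter measurableSet_Ioc) (hfin _) (hfin _),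
      ← inter_union_distrib_left, Iic_union_Ioc_eq_Iic hst]
    exact (Iic_disjoint_Ioc le_rfl).mono inter_subset_right inter_subset_right
  have hle {s t : ℝ} (hst : s ≤ t) : volume.real (U ∩ Ioc s t) ≤ t - s := by
    refine (measureReal_mono inter_subset_right (by simp)).trans_eq ?_
    rw [Real.volume_real_Ioc_of_le hst]
  -- Subtracting the length of `U` to the left of `s` removes all growth on `U`, at a total cost
  -- below `η`.
  refine ⟨fun s => s - volume.real (U ∩ Iic s), ?_, fun s => ?_, fun z hz => ?_⟩
  · refine LipschitzWith.of_le_add fun s t => ?_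
    rcases le_total s t with hst | hst
    · have := hadd hst
      have := hle hst
      have := dist_nonneg (x := s) (y := t)
      linarith
    · have h1 := hadd hst
      have h2 : 0 ≤ volume.real (U ∩ Ioc t s) := measureReal_nonneg
      rw [Real.dist_eq, abs_of_nonneg (sub_nonneg.2 hst)]
      linarith
  · have h1 : volume.real (U ∩ Iic s) ≤ η := by
      refine (measureReal_mono inter_subset_left hUt).trans ?_
      exact ENNReal.toReal_le_of_le_ofReal hη.le hU.le
    have h2 : 0 ≤ volume.real (U ∩ Iic s) := measureReal_nonneg
    rw [sub_sub_cancel_left, abs_neg, abs_of_nonneg h2]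
    exact h1
  · obtain ⟨ε, hε, hb⟩ := Metric.isOpen_iff.1 hUo z (hZU hz)
    have hin {s t : ℝ} (hst : s ≤ t) (hs : s ∈ ball z ε) (ht : t ∈ ball z ε) :
        volume.real (U ∩ Ioc s t) = t - s := by
      rw [inter_eq_right.2, Real.volume_real_Ioc_of_le hst]
      refine Subset.trans (fun w hw => ?_) hb
      rw [Real.ball_eq_Ioo] at *
      exact ⟨hs.1.trans hw.1, hw.2.trans_lt ht.2⟩
    filter_upwards [ball_mem_nhds z hε] with s hs
    rcases le_total s z with hsz | hsz
    · have h1 := hadd hsz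
      have h2 := hin hsz hs (mem_ball_self hε)
      linarith
    · have h1 := hadd hsz
      have h2 := hin hsz (mem_ball_self hε) hs
      linarith

theorem norm_iteratedFDeriv_mul_le_of_le {f g : Plane → ℝ} (hf : ContDiff ℝ 2 f)
    (hg : ContDiff ℝ 2 g) {a b s : ℝ} (x : Plane)
    (ha : ∀ n ≤ 2, ‖iteratedFDeriv ℝ n f x‖ ≤ a * s ^ n)
    (hb : ∀ n ≤ 2, ‖iteratedFDeriv ℝ n g x‖ ≤ b * s ^ n) {n : ℕ} (hn : n ≤ 2) :
    ‖iteratedFDeriv ℝ n (fun y => f y * g y) x‖ ≤ 2 ^ n * (a * b * s ^ n) := by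
  refine (norm_iteratedFDeriv_mul_le hf hg x (by exact_mod_cast hn)).trans ?_
  have key : ∀ i ∈ Finset.range (n + 1),
      (n.choose i : ℝ) * ‖iteratedFDeriv ℝ i f x‖ * ‖iteratedFDeriv ℝ (n - i) g x‖ ≤
        n.choose i * (a * b * s ^ n) := by
    intro i hi
    have hi' : i ≤ n := by simpa [Nat.lt_succ_iff] using hi
    have h1 := ha i (hi'.trans hn)
    have h2 := hb (n - i) ((Nat.sub_le _ _).trans hn)
    rw [mul_assoc]
    refine mul_le_mul_of_nonneg_left ?_ (Nat.cast_nonneg _)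
    refine (mul_le_mul h1 h2 (norm_nonneg _) ((norm_nonneg _).trans h1)).trans_eq ?_
    rw [← Nat.add_sub_cancel' hi', Nat.add_sub_cancel_left, pow_add]
    ring
  refine (Finset.sum_le_sum key).trans_eq ?_
  rw [← Finset.sum_mul]
  congr 1
  exact_mod_cast Nat.sum_range_choose n

end

/-! ### Cutoffs around `K` and the multiscale gluing. -/

section
open MeasureTheory Metric Set Filter
open scoped Convolution

/-- A smooth cutoff at scale `t` around `K`. -/
noncomputable def cutoff (K : Set Plane) (t : ℝ) : Plane → ℝ :=
  mollify t ((thickening (2 * t) K).indicator fun _ => 1)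

theorem locallyIntegrable_indicator_thickening (K : Set Plane) (t : ℝ) :
    LocallyIntegrable ((thickening t K).indicator fun _ => (1 : ℝ)) :=
  (locallyIntegrable_const 1).indicator isOpen_thickening.measurableSet

theorem contDiff_cutoff (K : Set Plane) {t : ℝ} (ht : 0 < t) : ContDiff ℝ ∞ (cutoff K t) :=
  contDiff_mollify ht (locallyIntegrable_indicator_thickening K _)

theorem hasCompactSupport_cutoff {K : Set Plane} (hK : IsCompact K) {t : ℝ} (ht : 0 < t) :
    HasCompactSupport (cutoff K t) := by
  refine HasCompactSupport.convolution _ ?_ (hasCompactSupport_mollKernel ht)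
  refine HasCompactSupport.of_support_subset_isCompact (hK.cthickening (r := 2 * t)) ?_
  exact support_indicator_subset.trans (thickening_subset_cthickening _ _)

theorem mollify_eq_of_eqOn {t : ℝ} (ht : 0 < t) {f : Plane → ℝ} (hf : LocallyIntegrable f)
    {x : Plane} {c : ℝ} (h : ∀ y ∈ closedBall x t, f y = c) : mollify t f x = c := by
  obtain ⟨A, -, hA⟩ := exists_norm_iteratedFDeriv_mollify_le
  -- Oscillation bound `M = 0`.
  have := hA 0 (by norm_num) t ht f hf c 0 x fun y hy => by simp [h y hy]
  simpa [sub_eq_zero] using this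

theorem cutoff_eq_one {K : Set Plane} {t : ℝ} {x : Plane} (hx : x ∈ thickening t K) :
    cutoff K t x = 1 := by
  obtain ⟨p, hp, hxp⟩ := mem_thickening_iff.1 hx
  have ht : 0 < t := dist_nonneg.trans_lt hxp
  refine mollify_eq_of_eqOn ht (locallyIntegrable_indicator_thickening K _) fun y hy => ?_
  refine indicator_of_mem (mem_thickening_iff.2 ⟨p, hp, ?_⟩) _
  have := dist_triangle y x p
  rw [mem_closedBall] at hy
  linarith

theorem norm_iteratedFDeriv_const_le (n : ℕ) (c : ℝ) (x : Plane) :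
    ‖iteratedFDeriv ℝ n (fun _ : Plane => c) x‖ ≤ |c| := by
  rcases eq_or_ne n 0 with rfl | hn
  · simp
  · rw [iteratedFDeriv_const_of_ne hn]; simp

theorem norm_iteratedFDeriv_cutoff_le {A : ℝ}
    (hA : ∀ n ≤ 2, ∀ t : ℝ, 0 < t → ∀ f : Plane → ℝ, LocallyIntegrable f →
      ∀ (c M : ℝ) (x : Plane), (∀ y ∈ closedBall x t, |f y - c| ≤ M) →
      ‖iteratedFDeriv ℝ n (fun z => mollify t f z - c) x‖ ≤ A * M * t⁻¹ ^ n)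
    (K : Set Plane) {t : ℝ} (ht : 0 < t) {n : ℕ} (hn : n ≤ 2) (x : Plane) :
    ‖iteratedFDeriv ℝ n (cutoff K t) x‖ ≤ A * t⁻¹ ^ n := by
  have := hA n hn t ht _ (locallyIntegrable_indicator_thickening K (2 * t)) 0 1 x
    fun y _ => by by_cases hy : y ∈ thickening (2 * t) K <;> simp [hy]
  simpa [cutoff] using this

/-- A ball of radius `t` about such a point misses the `2 * t`-thickening, so the oscillation bound
applies with `M = 0`. -/
theorem iteratedFDeriv_cutoff_eq_zero {K : Set Plane} {t : ℝ} (ht : 0 < t) {n : ℕ} (hn : n ≤ 2)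
    {x : Plane} (hx : x ∉ thickening (3 * t) K) : iteratedFDeriv ℝ n (cutoff K t) x = 0 := by
  obtain ⟨A, -, hA⟩ := exists_norm_iteratedFDeriv_mollify_le
  have := hA n hn t ht _ (locallyIntegrable_indicator_thickening K (2 * t)) 0 0 x
    fun y hy => by
      rw [indicator_of_notMem]
      · simp
      · intro hy'
        obtain ⟨p, hp, hyp⟩ := mem_thickening_iff.1 hy'
        refine hx (mem_thickening_iff.2 ⟨p, hp, ?_⟩)
        have := dist_triangle_left x p y
        rw [mem_closedBall] at hy
        linarith
  simpa [cutoff] using this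

/-- The stages of the multiscale regularization: the function itself, and then the mollifications
of its modification at the dyadic scales `r / 2 ^ j`. -/
noncomputable def multiscaleStage (r : ℝ) (ψ H : Plane → ℝ) : ℕ → Plane → ℝ
  | 0 => ψ
  | j + 1 => mollify (r * (1 / 2) ^ j) H

theorem contDiff_multiscaleStage {r : ℝ} (hr : 0 < r) {ψ H : Plane → ℝ} (hψ : ContDiff ℝ 2 ψ)
    (hH : LocallyIntegrable H) : ∀ j, ContDiff ℝ 2 (multiscaleStage r ψ H j)
  | 0 => hψ
  | _ + 1 => mod_cast contDiff_infty.1 (contDiff_mollify (by positivity) hH) 2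

theorem norm_iteratedFDeriv_multiscaleStage_succ_le {A : ℝ}
    (hA : ∀ n ≤ 2, ∀ t : ℝ, 0 < t → ∀ f : Plane → ℝ, LocallyIntegrable f →
      ∀ (c M : ℝ) (x : Plane), (∀ y ∈ closedBall x t, |f y - c| ≤ M) →
      ‖iteratedFDeriv ℝ n (fun z => mollify t f z - c) x‖ ≤ A * M * t⁻¹ ^ n)
    {ψ H : Plane → ℝ} {C r : ℝ} (hC : 0 ≤ C) (hr : 0 < r) (hH : LocallyIntegrable H) {p : Plane}
    (hHp : ∀ y, |H y - H p| ≤ C * dist y p ^ 3) (j : ℕ) {x : Plane}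
    (hx : dist x p < 3 * (r * (1 / 2) ^ j)) {n : ℕ} (hn : n ≤ 2) :
    ‖iteratedFDeriv ℝ n (fun z => multiscaleStage r ψ H (j + 1) z - H p) x‖ ≤
      64 * A * C * (r * (1 / 2) ^ j) ^ 3 * (r * (1 / 2) ^ j)⁻¹ ^ n := by
  set t := r * (1 / 2) ^ j
  have ht : 0 < t := by positivity
  -- The mollification ball lies within `3 * t + t` of `p`; this gives `64 = 4 ^ 3`.
  refine (hA n hn t ht H hH (H p) (C * (4 * t) ^ 3) x fun y hy => ?_).trans_eq (by ring)
  refine (hHp y).trans ?_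
  have h1 := dist_triangle y x p
  rw [mem_closedBall] at hy
  gcongr
  linarith

/-- Stage `j` is measured at the scale of stage `j + 1`, so that consecutive stages can be compared.
In the constant, `512 = 64 * 2 ^ 3` pays for halving the scale, while `27 = 3 ^ 3` and `1` come from
stage zero, where `ψ` and `H` differ at `p` by at most `r ^ 3`. -/
theorem norm_iteratedFDeriv_multiscaleStage_le {A : ℝ} (hA1 : 1 ≤ A)
    (hA : ∀ n ≤ 2, ∀ t : ℝ, 0 < t → ∀ f : Plane → ℝ, LocallyIntegrable f →
      ∀ (c M : ℝ) (x : Plane), (∀ y ∈ closedBall x t, |f y - c| ≤ M) →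
      ‖iteratedFDeriv ℝ n (fun z => mollify t f z - c) x‖ ≤ A * M * t⁻¹ ^ n)
    {ψ H : Plane → ℝ} {C r : ℝ} (hψ : ContDiff ℝ 2 ψ) (hC : 0 ≤ C) (hr : 0 < r) (hr1 : r ≤ 1)
    (hH : LocallyIntegrable H) {p : Plane}
    (hp : ∀ y, ∀ n ≤ 2, ‖iteratedFDeriv ℝ n (fun z => ψ z - ψ p) y‖ ≤ C * dist y p ^ (3 - n))
    (hpH : |ψ p - H p| ≤ r ^ 3)
    (hHp : ∀ y, |H y - H p| ≤ C * dist y p ^ 3) (j : ℕ) {x : Plane}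
    (hx : dist x p < 3 * (r * (1 / 2) ^ j)) {n : ℕ} (hn : n ≤ 2) :
    ‖iteratedFDeriv ℝ n (fun z => multiscaleStage r ψ H j z - H p) x‖ ≤
      (512 * A * C + 27 * C + 1) * (r * (1 / 2) ^ j) ^ 3 * (r * (1 / 2) ^ j)⁻¹ ^ n := by
  have hA0 : 0 ≤ A := zero_le_one.trans hA1
  cases j with
  | zero =>
    simp only [multiscaleStage, pow_zero, mul_one] at hx ⊢
    have h1 : (fun z => ψ z - H p) = (fun z => ψ z - ψ p) + fun _ => ψ p - H p := by
      ext z; simp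
    rw [h1, iteratedFDeriv_add_apply
      ((hψ.sub contDiff_const).of_le (by exact_mod_cast hn)).contDiffAt contDiffAt_const]
    have hrn : 1 ≤ r⁻¹ ^ n := one_le_pow₀ ((one_le_inv₀ hr).2 hr1)
    have h2 : ‖iteratedFDeriv ℝ n (fun z => ψ z - ψ p) x‖ ≤ 27 * C * r ^ 3 * r⁻¹ ^ n := by
      refine (hp x n hn).trans ?_
      have h3 : r ^ 3 * r⁻¹ ^ n = r ^ (3 - n) := by
        rw [inv_pow, pow_sub₀ r hr.ne' (by omega)]
      have h4 : (3 : ℝ) ^ (3 - n) ≤ 27 := by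
        calc (3 : ℝ) ^ (3 - n) ≤ 3 ^ 3 := pow_le_pow_right₀ (by norm_num) (by omega)
          _ = 27 := by norm_num
      calc C * dist x p ^ (3 - n) ≤ C * (3 * r) ^ (3 - n) := by gcongr
        _ = 3 ^ (3 - n) * C * r ^ (3 - n) := by rw [mul_pow]; ring
        _ ≤ 27 * C * r ^ (3 - n) := by gcongr
        _ = _ := by rw [mul_assoc _ (r ^ 3), h3]
    have h5 : |ψ p - H p| ≤ r ^ 3 * r⁻¹ ^ n :=
      hpH.trans (le_mul_of_one_le_right (by positivity) hrn)
    have h6 : 0 ≤ 512 * A * C * r ^ 3 * r⁻¹ ^ n := by positivity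
    refine (norm_add_le _ _).trans ((add_le_add h2
      ((norm_iteratedFDeriv_const_le n _ x).trans h5)).trans ?_)
    linarith
  | succ j =>
    set t := r * (1 / 2) ^ (j + 1) with ht
    have ht0 : 0 < t := by positivity
    have h2t : r * (1 / 2) ^ j = 2 * t := by rw [ht, pow_succ]; ring
    refine (norm_iteratedFDeriv_multiscaleStage_succ_le hA hC hr hH hHp j
      (by rw [h2t]; linarith) hn).trans ?_
    rw [h2t]
    calc 64 * A * C * (2 * t) ^ 3 * (2 * t)⁻¹ ^ n ≤ 64 * A * C * (2 * t) ^ 3 * t⁻¹ ^ n := by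
          gcongr; linarith
      _ = 512 * A * C * t ^ 3 * t⁻¹ ^ n := by ring
      _ ≤ _ := by
          gcongr
          linarith

theorem exists_multiscale_approx {K : Set Plane} (hK : IsCompact K) {ψ : Plane → ℝ}
    (hψ : ContDiff ℝ 2 ψ) {C : ℝ} (hC : 0 ≤ C)
    (h : ∀ p ∈ K, ∀ y, ∀ n ≤ 2,
      ‖iteratedFDeriv ℝ n (fun z => ψ z - ψ p) y‖ ≤ C * dist y p ^ (3 - n))
    {ε : ℝ} (hε : 0 < ε) :
    ∃ E : Plane → ℝ, ContDiff ℝ 2 E ∧ HasCompactSupport (fun x => E x - ψ x) ∧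
      (∃ δ > 0, ∀ x ∈ thickening δ K, fderiv ℝ E x = 0) ∧
      ∀ x, ∀ n ≤ 2, ‖iteratedFDeriv ℝ n (fun z => E z - ψ z) x‖ ≤ ε := by
  obtain ⟨A, hA1, hA⟩ := exists_norm_iteratedFDeriv_mollify_le
  have hA0 : 0 ≤ A := zero_le_one.trans hA1
  have hcub (p : Plane) (hp : p ∈ K) (y : Plane) : |ψ y - ψ p| ≤ C * dist y p ^ 3 := by
    simpa using h p hp y 0 (by norm_num)
  -- Leibniz factor `2 ^ 2`, cutoff bound `A`, then the bounds for the two consecutive stages.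
  set D : ℝ := 4 * A * (64 * A * C + (512 * A * C + 27 * C + 1)) with hD
  have hD0 : 0 < D := by positivity
  obtain ⟨r, hr, hr1, hrε⟩ : ∃ r : ℝ, 0 < r ∧ r ≤ 1 ∧ 2 * D * r ≤ ε := by
    refine ⟨min 1 (ε / (2 * D)), by positivity, min_le_left _ _, ?_⟩
    calc 2 * D * min 1 (ε / (2 * D)) ≤ 2 * D * (ε / (2 * D)) := by
          gcongr; exact min_le_right _ _
      _ = ε := by field_simp
  obtain ⟨g, hgL, hgη, hgc⟩ := exists_lipschitz_locallyConstant_near_null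
    (volume_image_eq_zero_of_cubic fun x hx y hy => hcub y hy x) (pow_pos hr 3)
  set H : Plane → ℝ := g ∘ ψ with hHdef
  have hHc : Continuous H := hgL.continuous.comp hψ.continuous
  have hHi : LocallyIntegrable H := hHc.locallyIntegrable
  have hHp (p : Plane) (hp : p ∈ K) (y : Plane) : |H y - H p| ≤ C * dist y p ^ 3 := by
    refine le_trans ?_ (hcub p hp y)
    simpa [Real.dist_eq, hHdef] using hgL.dist_le_mul (ψ y) (ψ p)
  obtain ⟨ρ, hρ, hρK⟩ : ∃ ρ > 0, ∀ p ∈ K, ∀ y ∈ ball p ρ, H y = H p := by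
    have hloc (p : K) : ∀ᶠ y in 𝓝 (p : Plane), H y = H p :=
      hψ.continuous.continuousAt.eventually (hgc _ (mem_image_of_mem ψ p.2))
    -- Compactness makes the radius of local constancy uniform over `K`.
    obtain ⟨ρ, hρ, hb⟩ := lebesgue_number_lemma_of_metric hK
      (c := fun p : K => interior {y | H y = H p}) (fun _ => isOpen_interior)
      fun p hp => mem_iUnion.2 ⟨⟨p, hp⟩, mem_interior_iff_mem_nhds.2 (hloc ⟨p, hp⟩)⟩
    refine ⟨ρ, hρ, fun p hp y hy => ?_⟩
    obtain ⟨i, hi⟩ := hb p hp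
    have h1 : H y = H i := interior_subset (s := {y | H y = H i}) (hi hy)
    have h2 : H p = H i := interior_subset (s := {y | H y = H i}) (hi (mem_ball_self hρ))
    rw [h1, h2]
  -- One `t N` for the distance to `K`, another for the mollification ball.
  obtain ⟨N, hN⟩ : ∃ N : ℕ, 2 * (r * (1 / 2) ^ N) < ρ := by
    obtain ⟨N, hN⟩ := exists_pow_lt_of_lt_one (show 0 < ρ / (2 * r) by positivity)
      (show (1 / 2 : ℝ) < 1 by norm_num)
    refine ⟨N, ?_⟩
    rw [lt_div_iff₀ (by positivity)] at hN
    linarith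
  set G := multiscaleStage r ψ H with hG
  have hGc (j : ℕ) : ContDiff ℝ 2 (G j) := contDiff_multiscaleStage hr hψ hHi j
  set t : ℕ → ℝ := fun j => r * (1 / 2) ^ j with ht
  have ht0 (j : ℕ) : 0 < t j := by positivity
  have htle (j : ℕ) : t j ≤ 1 := by
    have : (1 / 2 : ℝ) ^ j ≤ 1 := pow_le_one₀ (by norm_num) (by norm_num)
    calc t j ≤ 1 * 1 := by simp only [ht]; gcongr
      _ = 1 := one_mul 1
  set T : ℕ → Plane → ℝ := fun j x => cutoff K (t j) x * (G (j + 1) x - G j x) with hT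
  have hcut (j : ℕ) : ContDiff ℝ 2 (cutoff K (t j)) :=
    mod_cast contDiff_infty.1 (contDiff_cutoff K (ht0 j)) 2
  have hTc (j : ℕ) : ContDiff ℝ 2 (T j) := (hcut j).mul ((hGc _).sub (hGc _))
  have hTn (j : ℕ) (x : Plane) (n : ℕ) (hn : n ≤ 2) : ‖iteratedFDeriv ℝ n (T j) x‖ ≤ D * t j := by
    by_cases hx : x ∈ thickening (3 * t j) K
    · obtain ⟨p, hp, hxp⟩ := mem_thickening_iff.1 hx
      have hdiff (m : ℕ) (hm : m ≤ 2) :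
          ‖iteratedFDeriv ℝ m (fun z => G (j + 1) z - G j z) x‖ ≤
            (64 * A * C + (512 * A * C + 27 * C + 1)) * t j ^ 3 * (t j)⁻¹ ^ m := by
        have h1 : (fun z => G (j + 1) z - G j z) =
            (fun z => G (j + 1) z - H p) - fun z => G j z - H p := by ext z; simp
        rw [h1, iteratedFDeriv_sub_apply
          (((hGc _).sub contDiff_const).of_le (by exact_mod_cast hm)).contDiffAt
          (((hGc _).sub contDiff_const).of_le (by exact_mod_cast hm)).contDiffAt]
        refine (norm_sub_le _ _).trans ((add_le_add
          (norm_iteratedFDeriv_multiscaleStage_succ_le hA hC hr hHi (hHp p hp) j hxp hm)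
          (norm_iteratedFDeriv_multiscaleStage_le hA1 hA hψ hC hr hr1 hHi (h p hp)
            (by rw [abs_sub_comm]; exact hgη _) (hHp p hp) j hxp hm)).trans_eq ?_)
        simp only [ht]
        ring
      refine (norm_iteratedFDeriv_mul_le_of_le (hcut j) ((hGc _).sub (hGc _)) x
        (fun m hm => norm_iteratedFDeriv_cutoff_le hA K (ht0 j) hm x) hdiff hn).trans ?_
      -- The cubic order of vanishing beats two derivatives and leaves a summable factor.
      have h2 : t j ^ 3 * (t j)⁻¹ ^ n ≤ t j := by
        rw [inv_pow, ← div_eq_mul_inv, div_le_iff₀ (pow_pos (ht0 j) n)]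
        calc t j ^ 3 = t j * t j ^ 2 := by ring
          _ ≤ t j * t j ^ n := by
            have := ht0 j
            gcongr t j * ?_
            exact pow_le_pow_of_le_one (ht0 j).le (htle j) hn
      have h3 : (2 : ℝ) ^ n ≤ 4 := by
        calc (2 : ℝ) ^ n ≤ 2 ^ 2 := pow_le_pow_right₀ (by norm_num) hn
          _ = 4 := by norm_num
      have := (ht0 j).le
      calc _ = 2 ^ n * (A * (64 * A * C + (512 * A * C + 27 * C + 1))) *
            (t j ^ 3 * (t j)⁻¹ ^ n) := by ring
        _ ≤ 4 * (A * (64 * A * C + (512 * A * C + 27 * C + 1))) * t j := by gcongr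
        _ = D * t j := by rw [hD]; ring
    · refine (norm_iteratedFDeriv_mul_le (hcut j) ((hGc _).sub (hGc _)) x
        (by exact_mod_cast hn)).trans ?_
      rw [Finset.sum_eq_zero]
      · exact mul_nonneg hD0.le (ht0 j).le
      · intro i hi
        rw [iteratedFDeriv_cutoff_eq_zero (ht0 j) ((Finset.mem_range_succ_iff.1 hi).trans hn) hx]
        simp
  have hdiff : (fun x => (ψ x + ∑ j ∈ Finset.range (N + 1), T j x) - ψ x) =
      fun x => ∑ j ∈ Finset.range (N + 1), T j x := by ext; simp
  refine ⟨fun x => ψ x + ∑ j ∈ Finset.range (N + 1), T j x,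
    hψ.add (ContDiff.sum fun j _ => hTc j), ?_, ⟨t N, ht0 N, fun x hx => ?_⟩, fun x n hn => ?_⟩
  · rw [hdiff]
    have : HasCompactSupport (∑ j ∈ Finset.range (N + 1), T j) := by
      refine Finset.sum_induction _ HasCompactSupport (fun _ _ => HasCompactSupport.add)
        HasCompactSupport.zero fun j _ => (hasCompactSupport_cutoff hK (ht0 j)).mul_right
    convert this using 2
    simp
  · obtain ⟨p, hp, hxp⟩ := mem_thickening_iff.1 hx
    -- Within `t N` of `K` every cutoff equals one, so the sum telescopes to `H` mollified at scale
    -- `t N`, which is locally constant there.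
    have hev : (fun x => ψ x + ∑ j ∈ Finset.range (N + 1), T j x) =ᶠ[𝓝 x] fun _ => H p := by
      filter_upwards [isOpen_ball.mem_nhds (mem_ball.2 hxp)] with y hy
      have hTj (j : ℕ) (hj : j ∈ Finset.range (N + 1)) : T j y = G (j + 1) y - G j y := by
        simp only [hT]
        rw [cutoff_eq_one, one_mul]
        refine mem_thickening_iff.2 ⟨p, hp, (mem_ball.1 hy).trans_le ?_⟩
        simp only [ht]
        gcongr ?_ * ?_
        exact pow_le_pow_of_le_one (by norm_num) (by norm_num)
          (Finset.mem_range_succ_iff.1 hj)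
      rw [Finset.sum_congr rfl hTj, Finset.sum_range_sub (fun j => G j y)]
      have h0 : G 0 y = ψ y := rfl
      rw [h0, add_sub_cancel]
      refine mollify_eq_of_eqOn (ht0 N) hHi fun z hz => hρK p hp z ?_
      rw [mem_ball] at hy ⊢
      rw [mem_closedBall] at hz
      have := dist_triangle z y p
      simp only [ht] at hy hz
      linarith
    rw [hev.fderiv_eq]
    simp
  · rw [hdiff, iteratedFDeriv_fun_sum_apply
      fun j _ => ((hTc j).of_le (by exact_mod_cast hn)).contDiffAt]
    have hs : ∑ j ∈ Finset.range (N + 1), (1 / 2 : ℝ) ^ j ≤ 2 := sum_geometric_two_le _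
    calc _ ≤ ∑ j ∈ Finset.range (N + 1), D * t j :=
          norm_sum_le_of_le _ fun j _ => hTn j x n hn
      _ = D * r * ∑ j ∈ Finset.range (N + 1), (1 / 2 : ℝ) ^ j := by
          rw [Finset.mul_sum]; exact Finset.sum_congr rfl fun j _ => by simp only [ht]; ring
      _ ≤ D * r * 2 := by gcongr
      _ ≤ ε := by linarith

end

/-! ### Stream functions and divergence-free approximation. -/

section
open MeasureTheory Metric Set Filter
open scoped Convolution

/-- The rotated gradient `ℓ ↦ (ℓ e₁, -ℓ e₀)`, as a linear map on covectors. -/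
noncomputable def rotVec : (Plane →L[ℝ] ℝ) →L[ℝ] Plane :=
  (ContinuousLinearMap.apply ℝ ℝ (EuclideanSpace.single 1 1 : Plane)).smulRight
      (EuclideanSpace.single 0 1) -
    (ContinuousLinearMap.apply ℝ ℝ (EuclideanSpace.single 0 1 : Plane)).smulRight
      (EuclideanSpace.single 1 1)

/-- The covector `u₀ dx₁ - u₁ dx₀` associated with a vector `u`. -/
noncomputable def rotCovec : Plane →L[ℝ] Plane →L[ℝ] ℝ :=
  (EuclideanSpace.proj 0 : Plane →L[ℝ] ℝ).smulRight (EuclideanSpace.proj 1 : Plane →L[ℝ] ℝ) -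
    (EuclideanSpace.proj 1 : Plane →L[ℝ] ℝ).smulRight (EuclideanSpace.proj 0 : Plane →L[ℝ] ℝ)

theorem rotCovec_apply (u v : Plane) : rotCovec u v = u 0 * v 1 - u 1 * v 0 := by
  simp [rotCovec]

theorem rotVec_apply_zero (l : Plane →L[ℝ] ℝ) : rotVec l 0 = l (EuclideanSpace.single 1 1) := by
  simp [rotVec]

theorem rotVec_apply_one (l : Plane →L[ℝ] ℝ) : rotVec l 1 = -l (EuclideanSpace.single 0 1) := by
  simp [rotVec]

theorem rotVec_rotCovec (u : Plane) : rotVec (rotCovec u) = u := by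
  ext i
  fin_cases i
  · simp [rotVec_apply_zero, rotCovec_apply]
  · simp [rotVec_apply_one, rotCovec_apply]

/-- This is the Poincaré lemma: the exterior derivative of `u₀ dx₁ - u₁ dx₀` is `(div u) dx₀ ∧ dx₁`.
-/
theorem exists_stream_function {u : Plane → Plane} (hu : Differentiable ℝ u)
    (hdiv : ∀ x, planeDiv u x = 0) : ∃ ψ : Plane → ℝ, ∀ x, HasFDerivAt ψ (rotCovec (u x)) x := by
  have hI (x : Plane) (_ : x ∈ univ) : HasFDerivWithinAt (fun y => rotCovec (u y))
      (rotCovec ∘L fderiv ℝ u x) univ x :=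
    (rotCovec.hasFDerivAt.comp x (hu x).hasFDerivAt).hasFDerivWithinAt
  obtain ⟨ψ, hψ⟩ :=
    convex_univ.exists_forall_hasFDerivWithinAt_of_hasFDerivWithinAt_symmetric hI (by
      intro x _ a _ b _
      have hd := hdiv x
      simp only [planeDiv, Fin.sum_univ_two] at hd
      have hexp (c : Plane) : c = c 0 • EuclideanSpace.single 0 (1 : ℝ) +
          c 1 • EuclideanSpace.single 1 (1 : ℝ) := by
        ext i; fin_cases i <;> simp
      have hM (c : Plane) (i : Fin 2) : fderiv ℝ u x c i =
          c 0 * fderiv ℝ u x (EuclideanSpace.single 0 1) i +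
            c 1 * fderiv ℝ u x (EuclideanSpace.single 1 1) i := by
        conv_lhs => rw [hexp c]
        simp
      simp only [ContinuousLinearMap.comp_apply, rotCovec_apply, hM a, hM b]
      linear_combination (a 0 * b 1 - b 0 * a 1) * hd)
  exact ⟨ψ, fun x => by simpa using hψ x (mem_univ x)⟩

/-- Mean value inequality on the closed ball about `p` through `y`: integrating gains one order of
vanishing. -/
theorem norm_le_pow_succ_of_fderiv_le {F : Type*} [NormedAddCommGroup F] [NormedSpace ℝ F]
    {f : Plane → F} (hf : Differentiable ℝ f) {p : Plane} (hp : f p = 0) {C : ℝ} (hC : 0 ≤ C)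
    {k : ℕ} (h : ∀ y, ‖fderiv ℝ f y‖ ≤ C * dist y p ^ k) (y : Plane) :
    ‖f y‖ ≤ C * dist y p ^ (k + 1) := by
  have := (convex_closedBall p (dist y p)).norm_image_sub_le_of_norm_fderiv_le (𝕜 := ℝ)
    (f := f) (C := C * dist y p ^ k) (fun z _ => hf z) (fun z hz => (h z).trans (by
      gcongr; exact mem_closedBall.1 hz)) (mem_closedBall_self dist_nonneg)
    (mem_closedBall.2 le_rfl)
  rw [hp, sub_zero, ← dist_eq_norm, mul_assoc, ← pow_succ] at this
  exact this

theorem norm_iteratedFDeriv_two {F : Type*} [NormedAddCommGroup F] [NormedSpace ℝ F]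
    (f : Plane → F) (x : Plane) : ‖iteratedFDeriv ℝ 2 f x‖ = ‖fderiv ℝ (fderiv ℝ f) x‖ := by
  rw [← norm_iteratedFDeriv_fderiv (n := 1), norm_iteratedFDeriv_one]

theorem planeDiv_rotVec_fderiv {E : Plane → ℝ} (hE : ContDiff ℝ 2 E) (x : Plane) :
    planeDiv (fun y => rotVec (fderiv ℝ E y)) x = 0 := by
  have hd : DifferentiableAt ℝ (fderiv ℝ E) x :=
    (hE.fderiv_right (m := 1) (by norm_num)).differentiable (by norm_num) x
  have h1 : fderiv ℝ (fun y => rotVec (fderiv ℝ E y)) x = rotVec ∘L fderiv ℝ (fderiv ℝ E) x :=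
    (rotVec.hasFDerivAt.comp x hd.hasFDerivAt).fderiv
  have hs := (hE.contDiffAt (x := x)).isSymmSndFDerivAt (by simp)
  simp only [planeDiv, h1, Fin.sum_univ_two, ContinuousLinearMap.comp_apply, rotVec_apply_zero,
    rotVec_apply_one]
  rw [hs.eq (EuclideanSpace.single 0 1)]
  ring

/-- Divergence is a fixed linear functional of the derivative, so it commutes with convolution. A
mollification radius of at most `δ / 2` preserves vanishing near `K`, and uniform continuity gives
closeness. -/
theorem exists_smooth_divFree_approx {K : Set Plane} {w : Plane → Plane} (hw : ContDiff ℝ 1 w)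
    (hwc : HasCompactSupport w) (hdiv : ∀ x, planeDiv w x = 0) {δ : ℝ} (hδ : 0 < δ)
    (hwK : ∀ x ∈ thickening δ K, w x = 0) {ε : ℝ} (hε : 0 < ε) :
    ∃ v : Plane → Plane, ContDiff ℝ ∞ v ∧ HasCompactSupport v ∧ (∀ x, planeDiv v x = 0) ∧
      tsupport v ⊆ Kᶜ ∧ (∀ x, dist (v x) (w x) ≤ ε) ∧
      ∀ x, dist (fderiv ℝ v x) (fderiv ℝ w x) ≤ ε := by
  have hDw : Continuous (fderiv ℝ w) := hw.continuous_fderiv (by norm_num)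
  obtain ⟨s₁, hs₁, h₁⟩ := Metric.uniformContinuous_iff.1
    (hwc.uniformContinuous_of_continuous hw.continuous) ε hε
  obtain ⟨s₂, hs₂, h₂⟩ := Metric.uniformContinuous_iff.1
    ((hwc.fderiv ℝ).uniformContinuous_of_continuous hDw) ε hε
  set s := min (min s₁ s₂) (δ / 2) with hs
  have hs0 : 0 < s := by positivity
  let φ : ContDiffBump (0 : Plane) := ⟨s / 2, s, by positivity, by linarith⟩
  have hφi : LocallyIntegrable (φ.normed volume : Plane → ℝ) :=
    φ.continuous_normed.locallyIntegrable
  set v : Plane → Plane := φ.normed volume ⋆[ContinuousLinearMap.lsmul ℝ ℝ, volume] w with hv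
  have hvd (x : Plane) : fderiv ℝ v x =
      (φ.normed volume ⋆[ContinuousLinearMap.lsmul ℝ ℝ, volume] fderiv ℝ w) x :=
    (hasFDerivAt_convolution_lsmul hφi hwc hw x).fderiv
  have hv0 : ∀ x ∈ thickening (δ / 2) K, v x = 0 := by
    intro x hx
    obtain ⟨p, hp, hxp⟩ := mem_thickening_iff.1 hx
    have h0 : ∀ y ∈ ball x s, w y = 0 := by
      intro y hy
      refine hwK y (mem_thickening_iff.2 ⟨p, hp, ?_⟩)
      have h3 := dist_triangle y x p
      have h4 : s ≤ δ / 2 := min_le_right _ _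
      rw [mem_ball] at hy
      linarith
    have hx0 := h0 x (mem_ball_self hs0)
    rw [hv, φ.normed_convolution_eq_right fun y hy => by rw [h0 y hy, hx0], hx0]
  refine ⟨v, ?_, ?_, fun x => ?_, ?_, fun x => ?_, fun x => ?_⟩
  · exact φ.hasCompactSupport_normed.contDiff_convolution_left _ φ.contDiff_normed
      hw.continuous.locallyIntegrable
  · exact φ.hasCompactSupport_normed.convolution _ hwc
  · let L : (Plane →L[ℝ] Plane) →L[ℝ] ℝ := ∑ i : Fin 2,
      (EuclideanSpace.proj i : Plane →L[ℝ] ℝ) ∘L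
        ContinuousLinearMap.apply ℝ Plane (EuclideanSpace.single i 1 : Plane)
    have hL (f : Plane → Plane) (y : Plane) : planeDiv f y = L (fderiv ℝ f y) := by
      simp [planeDiv, L]
    have hex : ConvolutionExistsAt (φ.normed volume) (fderiv ℝ w) x
        (ContinuousLinearMap.lsmul ℝ ℝ) volume :=
      (hwc.fderiv ℝ).convolutionExists_right _ hφi hDw x
    rw [hL, hvd, convolution, ← L.integral_comp_comm hex]
    simp [← hL, hdiv]
  · intro x hx hxK
    refine (notMem_tsupport_iff_eventuallyEq.2 ?_) hx
    filter_upwards [isOpen_thickening.mem_nhds (self_subset_thickening (half_pos hδ) K hxK)]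
      with y hy using hv0 y hy
  · refine φ.dist_normed_convolution_le hw.continuous.aestronglyMeasurable fun y hy => (h₁ ?_).le
    exact (mem_ball.1 hy).trans_le ((min_le_left _ _).trans (min_le_left _ _))
  · rw [hvd]
    refine φ.dist_normed_convolution_le hDw.aestronglyMeasurable fun y hy => (h₂ ?_).le
    exact (mem_ball.1 hy).trans_le ((min_le_left _ _).trans (min_le_right _ _))

theorem exists_norm_fderiv_le {F : Type*} [NormedAddCommGroup F] [NormedSpace ℝ F]
    {f : Plane → F} (hf : ContDiff ℝ 1 f) (hfc : HasCompactSupport f) :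
    ∃ C, ∀ x, ‖fderiv ℝ f x‖ ≤ C :=
  (hfc.fderiv ℝ).exists_bound_of_continuous (hf.continuous_fderiv one_ne_zero)

/-- Start from a global bound on the second derivative of `u` and integrate three times from `p`:
orders 1, 2 and 3 for `fderiv ℝ u`, `u` and `ψ - ψ p`. -/
theorem exists_stream_function_of_vanishing {K : Set Plane} {u : Plane → Plane}
    (hu : ContDiff ℝ 2 u) (hsupp : HasCompactSupport u) (hdiv : ∀ x, planeDiv u x = 0)
    (hu0 : ∀ x ∈ K, u x = 0) (hu1 : ∀ x ∈ K, fderiv ℝ u x = 0) :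
    ∃ (ψ : Plane → ℝ) (C : ℝ), (∀ x, HasFDerivAt ψ (rotCovec (u x)) x) ∧ ContDiff ℝ 2 ψ ∧
      0 ≤ C ∧ ∀ p ∈ K, ∀ y, ∀ n ≤ 2,
        ‖iteratedFDeriv ℝ n (fun z => ψ z - ψ p) y‖ ≤ C * dist y p ^ (3 - n) := by
  have hud : Differentiable ℝ u := hu.differentiable (by norm_num)
  have hDu : ContDiff ℝ 1 (fderiv ℝ u) := hu.fderiv_right (by norm_num)
  obtain ⟨ψ, hψ⟩ := exists_stream_function hud hdiv
  have hψ1 : fderiv ℝ ψ = fun x => rotCovec (u x) := funext fun x => (hψ x).fderiv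
  have hψ2 (x : Plane) : fderiv ℝ (fderiv ℝ ψ) x = rotCovec ∘L fderiv ℝ u x := by
    rw [hψ1]
    exact (rotCovec.hasFDerivAt.comp x (hud x).hasFDerivAt).fderiv
  have hψd : Differentiable ℝ ψ := fun x => (hψ x).differentiableAt
  have hψc : ContDiff ℝ 2 ψ := by
    have : ContDiff ℝ (1 + 1) ψ := contDiff_succ_iff_fderiv.2 ⟨hψd, by simp, by
      rw [hψ1]; exact rotCovec.contDiff.comp (hu.of_le (by norm_num))⟩
    exact this.of_le (by norm_num)
  obtain ⟨C₀, hC₀⟩ := exists_norm_fderiv_le hDu (hsupp.fderiv ℝ)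
  have hC₀0 : 0 ≤ C₀ := (norm_nonneg _).trans (hC₀ 0)
  have hb1 (p : Plane) (hp : p ∈ K) (y : Plane) : ‖fderiv ℝ u y‖ ≤ C₀ * dist y p ^ 1 :=
    norm_le_pow_succ_of_fderiv_le (f := fderiv ℝ u) (hDu.differentiable one_ne_zero) (hu1 p hp)
      hC₀0 (k := 0) (fun z => by rw [pow_zero, mul_one]; exact hC₀ z) y
  have hb0 (p : Plane) (hp : p ∈ K) (y : Plane) : ‖u y‖ ≤ C₀ * dist y p ^ 2 :=
    norm_le_pow_succ_of_fderiv_le (k := 1) hud (hu0 p hp) hC₀0 (hb1 p hp) y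
  set C := ‖rotCovec‖ * C₀ with hC
  have hC0 : 0 ≤ C := by positivity
  have hc1 (p : Plane) (hp : p ∈ K) (y : Plane) : ‖fderiv ℝ ψ y‖ ≤ C * dist y p ^ 2 := by
    rw [hψ1, hC, mul_assoc]
    exact (rotCovec.le_opNorm _).trans (by gcongr; exact hb0 p hp y)
  refine ⟨ψ, C, hψ, hψc, hC0, ?_⟩
  · intro p hp y n hn
    have hfs : fderiv ℝ (fun z => ψ z - ψ p) = fderiv ℝ ψ := funext fun z => fderiv_sub_const _
    obtain rfl | rfl | rfl : n = 0 ∨ n = 1 ∨ n = 2 := by omega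
    · rw [norm_iteratedFDeriv_zero]
      exact norm_le_pow_succ_of_fderiv_le (hψd.sub_const _) (sub_self _) hC0
        (k := 2) (fun z => by rw [hfs]; exact hc1 p hp z) y
    · rw [norm_iteratedFDeriv_one, hfs]
      exact hc1 p hp y
    · rw [norm_iteratedFDeriv_two, hfs, hψ2, hC, mul_assoc]
      exact (ContinuousLinearMap.opNorm_comp_le _ _).trans (by gcongr; exact hb1 p hp y)

theorem exists_divFree_approx_off_compact {K : Set Plane} (hK : IsCompact K) {u : Plane → Plane}
    (hu : ContDiff ℝ 2 u) (hsupp : HasCompactSupport u) (hdiv : ∀ x, planeDiv u x = 0)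
    (hu0 : ∀ x ∈ K, u x = 0) (hu1 : ∀ x ∈ K, fderiv ℝ u x = 0) {ε : ℝ} (hε : 0 < ε) :
    ∃ v : Plane → Plane, (ContDiff ℝ ∞ v ∧ HasCompactSupport v ∧ (∀ x, planeDiv v x = 0) ∧
      tsupport v ⊆ Kᶜ) ∧ (∀ x, dist (v x) (u x) ≤ ε) ∧
      ∀ x, dist (fderiv ℝ v x) (fderiv ℝ u x) ≤ ε := by
  obtain ⟨ψ, C, hψ, hψc, hC0, hder⟩ := exists_stream_function_of_vanishing hu hsupp hdiv hu0 hu1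
  have hud : Differentiable ℝ u := hu.differentiable (by norm_num)
  have hψ1 : fderiv ℝ ψ = fun x => rotCovec (u x) := funext fun x => (hψ x).fderiv
  have hψd : Differentiable ℝ ψ := fun x => (hψ x).differentiableAt
  -- The `+ 1` keeps the divisor positive. Half of `ε` goes to the gluing, half to the final
  -- mollification.
  set B := ‖rotVec‖ + 1 with hB
  have hB0 : 0 < B := by positivity
  have hBε : ‖rotVec‖ * (ε / 2 / B) ≤ ε / 2 := by
    calc ‖rotVec‖ * (ε / 2 / B) ≤ B * (ε / 2 / B) := by gcongr; simp [hB]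
      _ = ε / 2 := by field_simp
  obtain ⟨E, hE, hEc, ⟨δ, hδ, hEδ⟩, hEε⟩ := exists_multiscale_approx hK hψc hC0 hder
    (show 0 < ε / 2 / B by positivity)
  have hEψ : ContDiff ℝ 2 (fun z => E z - ψ z) := hE.sub hψc
  have hEd : Differentiable ℝ E := hE.differentiable (by norm_num)
  set w : Plane → Plane := fun x => rotVec (fderiv ℝ E x) with hw
  have hwu : (fun x => w x - u x) = fun x => rotVec (fderiv ℝ (fun z => E z - ψ z) x) := by
    ext1 x
    rw [fderiv_fun_sub (hEd x) (hψd x), map_sub, hψ1, rotVec_rotCovec]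
  have hwC : ContDiff ℝ 1 w := rotVec.contDiff.comp (hE.fderiv_right (by norm_num))
  have hwc : HasCompactSupport w := by
    have h1 : HasCompactSupport fun x => w x - u x := by
      rw [hwu]
      exact (hEc.fderiv ℝ).comp_left (map_zero rotVec)
    have h2 : w = (fun x => w x - u x) + u := by ext1 x; simp
    rw [h2]
    exact h1.add hsupp
  have hw0 (x : Plane) : dist (w x) (u x) ≤ ε / 2 := by
    rw [dist_eq_norm, congrFun hwu x]
    refine (rotVec.le_opNorm _).trans (le_trans ?_ hBε)
    gcongr
    rw [← norm_iteratedFDeriv_one]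
    exact hEε x 1 (by norm_num)
  have hw1 (x : Plane) : dist (fderiv ℝ w x) (fderiv ℝ u x) ≤ ε / 2 := by
    have hd : DifferentiableAt ℝ (fderiv ℝ fun z => E z - ψ z) x :=
      (hEψ.fderiv_right (m := 1) (by norm_num)).differentiable (by norm_num) x
    have h3 : fderiv ℝ (fun y => rotVec (fderiv ℝ (fun z => E z - ψ z) y)) x =
        rotVec ∘L fderiv ℝ (fderiv ℝ fun z => E z - ψ z) x :=
      (rotVec.hasFDerivAt.comp x hd.hasFDerivAt).fderiv
    rw [dist_eq_norm, ← fderiv_fun_sub (hwC.differentiable (by norm_num) x) (hud x), hwu,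
      h3]
    refine (ContinuousLinearMap.opNorm_comp_le _ _).trans (le_trans ?_ hBε)
    gcongr
    rw [← norm_iteratedFDeriv_two]
    exact hEε x 2 le_rfl
  obtain ⟨v, hv, hvc, hvdiv, hvK, hv0, hv1⟩ := exists_smooth_divFree_approx hwC hwc
    (planeDiv_rotVec_fderiv hE) hδ (fun x hx => by rw [hw]; simp [hEδ x hx]) (half_pos hε)
  refine ⟨v, ⟨hv, hvc, hvdiv, hvK⟩, fun x => ?_, fun x => ?_⟩
  · linarith [dist_triangle (v x) (w x) (u x), hv0 x, hw0 x]
  · linarith [dist_triangle (fderiv ℝ v x) (fderiv ℝ w x) (fderiv ℝ u x), hv1 x, hw1 x]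

end

theorem theorem1p4 (K : Set Plane) (hK : IsCompact K) (u : Plane → Plane)
    (hu : ContDiff ℝ 2 u) (hsupp : HasCompactSupport u) (hdiv : ∀ x, planeDiv u x = 0)
    (hu0 : ∀ x ∈ K, u x = 0) (hu1 : ∀ x ∈ K, fderiv ℝ u x = 0) :
    ∃ v : ℕ → Plane → Plane,
      (∀ k, ContDiff ℝ ∞ (v k) ∧ HasCompactSupport (v k) ∧ (∀ x, planeDiv (v k) x = 0) ∧
        tsupport (v k) ⊆ Kᶜ) ∧
      TendstoC1 v u := by
  choose v hv hv0 hv1 using fun k : ℕ =>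
    exists_divFree_approx_off_compact hK hu hsupp hdiv hu0 hu1
      (Nat.one_div_pos_of_nat (α := ℝ) (n := k))
  refine ⟨v, hv, ?_, ?_⟩ <;> rw [Metric.tendstoUniformly_iff] <;> intro ε hε <;>
    filter_upwards [tendsto_one_div_add_atTop_nhds_zero_nat.eventually (gt_mem_nhds hε)]
      with k hk x
  · rw [dist_comm]
    exact (hv0 k x).trans_lt hk
  · rw [dist_comm]
    exact (hv1 k x).trans_lt hk
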